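/- One seller $s$ owns one indivisible item; there are two buyers $1,2$. A value profile is $v=(v_s,v_1,v_2)\in\mathbb R_{\ge 0}^3$. A (direct revelation, possibly randomized) mechanism $M=(A,p)$ assigns to every profile of reports $w\in\mathbb R_{\ge0}^3$ probabilities $A_s(w),A_1(w),A_2(w)\ge 0$ with sum $1$ that the respective agent ends up with the item, and (expected) payments $p_s(w),p_1(w),p_2(w)\in\mathbb R$, all measurable in $w$; a negative payment is received. When the reports are $w$, a buyer $b$ with value $x$ has utility $A_b(w)\,x-p_b(w)$, and a seller with value $x$ has utility $-(1-A_s(w))\,x-p_s(w)$. For a probability distribution $V$ on $[0,1]^3$ the gains from trade are $\mathrm{GFT}(M,V)=\mathbb E_{v\sim V}\big[\sum_{b=1,2}(v_b-v_s)A_b(v)\big]$. $M$ is simple if it is deterministic (in every instance some agent gets the item with probability $1$), dominant strategy incentive compatible (truth-telling is optimal for every agent, every value and all reports of the others), normalized (an agent that does not trade pays $0$), strongly budget balanced ($p_s+p_1+p_2=0$ for all reports) and ex-post individually rational (a truthful agent never has negative utility). $M$ is BIC/IIR/WBB for $V$ if all interim expected utilities (given an agent's value and report, the others reporting truthfully,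 with conditional expectations under $V$) exist and are finite; for every agent and almost every value of the agent, no report gives a larger interim expected utility than the truth (BIC), and truth-telling gives interim expected utility at least $0$ (IIR); and the payments are integrable with $\mathbb E_{v\sim V}[p_s(v)+p_1(v)+p_2(v)]\ge 0$ (WBB). A learning algorithm with $t$ samples maps a sequence of $t$ profiles and a random seed, independent of the samples, to a mechanism, such that the allocation probabilities of this mechanism are jointly measurable in samples, seed and reports; there is no restriction on its running time. Theorem. There is a constant $c>0$ such that for every $t\in\mathbb N$ and every $p>1/2$ there is no learning algorithm with $t$ samples with the following property: for every probability distribution $V$ on $[0,1]^3$ (with possibly correlated coordinates), if the algorithm is run on $t$ independent samples from $V$, then with probability at least $p$ its output is a mechanism $M$ that is simple or is BIC/IIR/WBB for $V$, and that satisfies $\mathrm{GFT}(M,V)\ge \mathrm{GFT}(M',V)-c$ for every simple mechanism $M'$. (If the event is not measurable, its probability means its outer measure.) -/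

import Mathlib

open MeasureTheory ProbabilityTheory
open scoped NNReal

universe u

noncomputable section

namespace Trade

/-- A profile of values (or of reports) of the three agents: agent `0` is the seller, agents `1` and
`2` are the two buyers. -/
abbrev Profile : Type := Fin 3 → ℝ≥0

/-- A direct revelation mechanism for one seller, two buyers and one item. `alloc v i` is the
probability with which agent `i` ends up with the item when the reports are `v`, and `pay v i` is the
(expected) payment of agent `i`; a negative payment is received. -/
structure Mechanism where
  alloc : Profile → Fin 3 → ℝ
  pay : Profile → Fin 3 → ℝ
  alloc_nonneg : ∀ v i, 0 ≤ alloc v i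
  alloc_sum : ∀ v, ∑ i, alloc v i = 1
  measurable_alloc : ∀ i, Measurable fun v => alloc v i
  measurable_pay : ∀ i, Measurable fun v => pay v i

namespace Mechanism

/-- The probability that agent `i` is involved in a trade: a buyer trades if he gets the item,
the seller trades if she does not keep it. -/
def tradeProb (M : Mechanism) (v : Profile) (i : Fin 3) : ℝ :=
  if i = 0 then 1 - M.alloc v 0 else M.alloc v i

/-- The (expected) utility of agent `i` with true value `x` when the reports are `w`. -/
def utility (M : Mechanism) (i : Fin 3) (x : ℝ≥0) (w : Profile) : ℝ :=
  if i = 0 then -(M.tradeProb w 0 * x) - M.pay w 0 else M.tradeProb w i * x - M.pay w i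

/-- In every instance one agent holds the item with certainty. -/
def IsDeterministic (M : Mechanism) : Prop :=
  ∀ v, ∃ i, M.alloc v i = 1

/-- An agent that does not trade neither pays nor receives anything. -/
def IsNormalized (M : Mechanism) : Prop :=
  ∀ v i, M.tradeProb v i = 0 → M.pay v i = 0

/-- Dominant strategy incentive compatibility: whatever the others report, an agent with value `x`
does not gain by reporting `r`. -/
def IsDSIC (M : Mechanism) : Prop :=
  ∀ (i : Fin 3) (x r : ℝ≥0) (w : Profile),
    M.utility i x (Function.update w i r) ≤ M.utility i x (Function.update w i x)

/-- Ex-post individual rationality. -/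
def IsExPostIR (M : Mechanism) : Prop :=
  ∀ (i : Fin 3) (x : ℝ≥0) (w : Profile), 0 ≤ M.utility i x (Function.update w i x)

/-- Ex-post strong budget balance. -/
def IsSBB (M : Mechanism) : Prop :=
  ∀ v, ∑ i, M.pay v i = 0

/-- Simple mechanisms: deterministic, DSIC, normalized, strongly budget balanced and ex-post
individually rational. -/
structure IsSimple (M : Mechanism) : Prop where
  deterministic : M.IsDeterministic
  dsic : M.IsDSIC
  normalized : M.IsNormalized
  sbb : M.IsSBB
  ir : M.IsExPostIR

end Mechanism

/-- The conditional law under `V` of the whole value profile given that agent `i` has value `x`. -/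
def interim (V : Measure Profile) [IsFiniteMeasure V] (i : Fin 3) (x : ℝ≥0) : Measure Profile :=
  condDistrib (fun v : Profile => v) (fun v : Profile => v i) V x

namespace Mechanism

/-- The expected utility of agent `i` given that her value is `x`, when she reports `r` and the
others report truthfully. -/
def interimUtility (M : Mechanism) (V : Measure Profile) [IsFiniteMeasure V] (i : Fin 3)
    (x r : ℝ≥0) : ℝ :=
  ∫ v, M.utility i x (Function.update v i r) ∂(interim V i x)

/-- All interim expected utilities, also those of untruthful reports, exist and are finite. -/
def HasInterimUtility (M : Mechanism) (V : Measure Profile) [IsFiniteMeasure V] : Prop :=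
  ∀ i : Fin 3, ∀ᵐ x ∂(V.map fun v => v i), ∀ r : ℝ≥0,
    Integrable (fun v => M.utility i x (Function.update v i r)) (interim V i x)

/-- Bayesian incentive compatibility with respect to the prior `V`: for almost every value `x`,
no report `r` gives more interim expected utility than the truth. -/
def IsBIC (M : Mechanism) (V : Measure Profile) [IsFiniteMeasure V] : Prop :=
  ∀ i : Fin 3, ∀ᵐ x ∂(V.map fun v => v i), ∀ r : ℝ≥0,
    M.interimUtility V i x r ≤ M.interimUtility V i x x

/-- Interim individual rationality with respect to the prior `V`. -/
def IsIIR (M : Mechanism) (V : Measure Profile) [IsFiniteMeasure V] : Prop :=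
  ∀ i : Fin 3, ∀ᵐ x ∂(V.map fun v => v i), 0 ≤ M.interimUtility V i x x

/-- Ex-ante weak budget balance with respect to the prior `V`: the expected payments exist, and the
mechanism does not lose money in expectation. -/
def IsWBB (M : Mechanism) (V : Measure Profile) : Prop :=
  (∀ i, Integrable (fun v => M.pay v i) V) ∧ 0 ≤ ∫ v, ∑ i, M.pay v i ∂V

/-- General mechanisms for the prior `V`: BIC, IIR and WBB. -/
structure IsGeneral (M : Mechanism) (V : Measure Profile) [IsFiniteMeasure V] : Prop where
  hasInterimUtility : M.HasInterimUtility V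
  bic : M.IsBIC V
  iir : M.IsIIR V
  wbb : M.IsWBB V

/-- Expected gains from trade of `M`, under truthful reports, on the prior `V`. -/
def gft (M : Mechanism) (V : Measure Profile) : ℝ :=
  ∫ v, (((v 1 : ℝ) - v 0) * M.alloc v 1 + ((v 2 : ℝ) - v 0) * M.alloc v 2) ∂V

/-- The gains from trade of `M` on `V` are, up to the additive error `c`, at least those of every
simple mechanism. -/
def IsNearOptimal (M : Mechanism) (V : Measure Profile) (c : ℝ) : Prop :=
  ∀ M' : Mechanism, M'.IsSimple → M'.gft V - c ≤ M.gft V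

end Mechanism

/-- A (possibly randomized) learning algorithm with `t` samples: it maps the samples and a random
seed, independent of the samples, to a mechanism. The allocation probabilities depend measurably on
samples, seed and reports together; nothing is assumed on its running time. -/
structure LearningAlgorithm (t : ℕ) where
  Seed : Type u
  [measurableSpaceSeed : MeasurableSpace Seed]
  seedLaw : Measure Seed
  [isProbabilityMeasure_seedLaw : IsProbabilityMeasure seedLaw]
  output : (Fin t → Profile) → Seed → Mechanism
  measurable_output : ∀ i : Fin 3,
    Measurable fun z : (Fin t → Profile) × Seed × Profile => (output z.1 z.2.1).alloc z.2.2 i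

attribute [instance] LearningAlgorithm.measurableSpaceSeed
attribute [instance] LearningAlgorithm.isProbabilityMeasure_seedLaw

/-- The probability, over `t` independent samples from `V` and the seed, that the algorithm outputs a
mechanism that is simple, or at least BIC, IIR and WBB for `V`, and whose gains from trade on `V` are
within `c` of the best simple mechanism for `V`. The event need not be measurable; its probability is
then understood as its outer measure. -/
def LearningAlgorithm.successProb {t : ℕ} (L : LearningAlgorithm.{u} t) (V : Measure Profile)
    [IsProbabilityMeasure V] (c : ℝ) : ℝ :=
  ((Measure.pi fun _ : Fin t => V).prod L.seedLaw).real
    {z | ((L.output z.1 z.2).IsSimple ∨ (L.output z.1 z.2).IsGeneral V) ∧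
      (L.output z.1 z.2).IsNearOptimal V c}

end Trade

end

noncomputable section

namespace Trade

/-! The hard priors are uniform on finite families with `N` hints. The second buyer's value encodes
the hint, which shifts the other two values, and each hint carries a hidden bit. Between the seller
and the first buyer one trade has gain 1/2, two small trades have gain 1/20 each, and one trade is
harmful. The bit decides which small trade is three times as likely as the other.

A simple mechanism knowing the bits posts, for each hint, the price that catches the large and the
likelier small trade (`gain_postedPrice`). A mechanism not knowing a bit would need both small
trades, but information rents make each of them cost budget, so that even BIC/IIR/WBB mechanisms
afford at most 5/4 small trades per hint on average (`sum_smallTrades_le`). Hence no allocation rule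
is near optimal both for a bit assignment and for one that disagrees with it on almost all hints
(`not_sum_gain_ge_of_flip`).

With `t` samples at most `t` hints are seen. Flipping all unseen bits permutes the assignments
without changing the samples, so at most one assignment of each pair succeeds. Averaged over all
assignments, the success probability is at most 1/2 (`two_mul_sum_measureReal_le`). -/

/-- The law of `X` when its argument is uniformly distributed on a finite type. -/
def uniformLaw {Ω : Type*} [MeasurableSpace Ω] (X : Ω → Profile) : Measure Profile :=
  (uniformOn (Set.univ : Set Ω)).map X

/-! ### Integrals and conditional laws under a uniform law on a finite family. -/

section Finite

variable {Ω : Type*} [MeasurableSpace Ω] [MeasurableSingletonClass Ω] [Fintype Ω]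

instance isProbabilityMeasure_uniformOn_univ [Nonempty Ω] :
    IsProbabilityMeasure (uniformOn (Set.univ : Set Ω)) :=
  isProbabilityMeasure_uniformOn Set.finite_univ Set.univ_nonempty

instance isProbabilityMeasure_uniformLaw [Nonempty Ω] (X : Ω → Profile) :
    IsProbabilityMeasure (uniformLaw X) :=
  Measure.isProbabilityMeasure_map (measurable_of_finite X).aemeasurable

theorem integral_uniformLaw (X : Ω → Profile) {g : Profile → ℝ} (hg : Measurable g) :
    ∫ v, g v ∂(uniformLaw X) = (Fintype.card Ω : ℝ)⁻¹ * ∑ ω, g (X ω) := by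
  rw [uniformLaw, integral_map (measurable_of_finite X).aemeasurable hg.aestronglyMeasurable,
    integral_fintype (Integrable.of_finite), Finset.mul_sum]
  refine Finset.sum_congr rfl fun ω _ => ?_
  simp [measureReal_def, uniformOn_univ]

theorem setIntegral_uniformLaw (X : Ω → Profile) {g : Profile → ℝ} (hg : Measurable g)
    (i : Fin 3) (x : ℝ≥0) :
    ∫ v in {v | v i = x}, g v ∂(uniformLaw X) =
      (Fintype.card Ω : ℝ)⁻¹ * ∑ ω, if X ω i = x then g (X ω) else 0 := by
  have hS : MeasurableSet {v : Profile | v i = x} :=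
    (measurableSet_singleton x).preimage (measurable_pi_apply i)
  rw [← integral_indicator hS, integral_uniformLaw X (hg.indicator hS)]
  simp [Set.indicator_apply]

theorem uniformLaw_map_singleton_ne_zero (X : Ω → Profile) (i : Fin 3) (ω : Ω) :
    (uniformLaw X).map (fun v => v i) {X ω i} ≠ 0 := by
  have hX : Measurable X := measurable_of_finite X
  rw [Measure.map_apply (measurable_pi_apply i) (measurableSet_singleton _), uniformLaw,
    Measure.map_apply hX (measurable_pi_apply i (measurableSet_singleton _))]
  refine (lt_of_lt_of_le ?_ (measure_mono (Set.singleton_subset_iff.2 (show ω ∈ _ from ?_)))).ne'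
  · simp [uniformOn_univ]
  · simp

end Finite

/-- At an atom the regular conditional law is elementary conditioning, so on finite priors interim
utilities become finite sums. -/
theorem interim_eq_restrict (V : Measure Profile) [IsFiniteMeasure V] (i : Fin 3) (x : ℝ≥0)
    (hx : V.map (fun v => v i) {x} ≠ 0) :
    interim V i x = (V.map (fun v => v i) {x})⁻¹ • V.restrict {v | v i = x} := by
  ext s hs
  rw [interim, condDistrib_apply_of_ne_zero (show Measurable fun v : Profile => v from measurable_id) x hx, Measure.smul_apply, smul_eq_mul,
    Measure.restrict_apply hs, Measure.map_apply (by fun_prop) ((measurableSet_singleton x).prod hs)]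
  congr 2
  ext v
  simp [and_comm]

/-! ### Interim constraints as finite inequalities. -/

namespace Mechanism

theorem measurable_utility (M : Mechanism) (i : Fin 3) (x : ℝ≥0) : Measurable (M.utility i x) := by
  have h0 := M.measurable_alloc 0
  have hi := M.measurable_alloc i
  have hp := M.measurable_pay i
  have hp0 := M.measurable_pay 0
  unfold utility tradeProb
  split_ifs <;> fun_prop

/-- The incentive, participation and budget constraints of a mechanism for the uniform law on the
finite family of profiles `X`, written as inequalities between finite sums. -/
structure SatisfiesFinite (M : Mechanism) {Ω : Type*} [Fintype Ω] (X : Ω → Profile) : Prop where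
  ic : ∀ (i : Fin 3) (x r : ℝ≥0),
    (∑ ω, if X ω i = x then M.utility i x (Function.update (X ω) i r) else 0) ≤
      ∑ ω, if X ω i = x then M.utility i x (X ω) else 0
  ir : ∀ (i : Fin 3) (x : ℝ≥0), 0 ≤ ∑ ω, if X ω i = x then M.utility i x (X ω) else 0
  bb : 0 ≤ ∑ ω, ∑ i, M.pay (X ω) i

theorem IsSimple.satisfiesFinite {M : Mechanism} (hM : M.IsSimple) {Ω : Type*} [Fintype Ω]
    (X : Ω → Profile) : M.SatisfiesFinite X where
  ic i x r := by
    refine Finset.sum_le_sum fun ω _ => ?_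
    split_ifs with h
    · simpa [← h] using hM.dsic i x r (X ω)
    · exact le_rfl
  ir i x := by
    refine Finset.sum_nonneg fun ω _ => ?_
    split_ifs with h
    · simpa [← h] using hM.ir i x (X ω)
    · exact le_rfl
  bb := by simp [hM.sbb _]

section

variable {Ω : Type*} [MeasurableSpace Ω] [MeasurableSingletonClass Ω] [Fintype Ω]

theorem interimUtility_uniformLaw [Nonempty Ω] (M : Mechanism) (X : Ω → Profile) (i : Fin 3) (ω₀ : Ω)
    (r : ℝ≥0) :
    M.interimUtility (uniformLaw X) i (X ω₀ i) r =
      (((uniformLaw X).map (fun v => v i) {X ω₀ i})⁻¹).toReal * ((Fintype.card Ω : ℝ)⁻¹ *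
        ∑ ω, if X ω i = X ω₀ i then M.utility i (X ω₀ i) (Function.update (X ω) i r) else 0) := by
  have hm : Measurable fun v : Profile => M.utility i (X ω₀ i) (Function.update v i r) :=
    (M.measurable_utility i _).comp (by fun_prop)
  rw [interimUtility, interim_eq_restrict _ _ _ (uniformLaw_map_singleton_ne_zero X i ω₀),
    integral_smul_measure, setIntegral_uniformLaw X hm, smul_eq_mul]

theorem IsGeneral.satisfiesFinite [Nonempty Ω] {M : Mechanism} {X : Ω → Profile}
    (hM : M.IsGeneral (uniformLaw X)) : M.SatisfiesFinite X := by
  have hcard : (0 : ℝ) < (Fintype.card Ω : ℝ)⁻¹ := by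
    have : 0 < Fintype.card Ω := Fintype.card_pos
    positivity
  have hpos : ∀ i ω₀, 0 < (((uniformLaw X).map (fun v => v i) {X ω₀ i})⁻¹).toReal := fun i ω₀ =>
    ENNReal.toReal_pos (ENNReal.inv_ne_zero.2 (measure_ne_top _ _))
      (ENNReal.inv_ne_top.2 (uniformLaw_map_singleton_ne_zero X i ω₀))
  have hself : ∀ (i : Fin 3) (x : ℝ≥0),
      (∑ ω, if X ω i = x then M.utility i x (Function.update (X ω) i x) else 0) =
        ∑ ω, if X ω i = x then M.utility i x (X ω) else 0 := by
    intro i x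
    refine Finset.sum_congr rfl fun ω _ => ?_
    split_ifs with h
    · rw [← h, Function.update_eq_self]
    · rfl
  -- Every value in the family is an atom of its marginal, so almost-everywhere statements hold
  -- there without exception.
  have hae : ∀ {i : Fin 3} {P : ℝ≥0 → Prop}, (∀ᵐ x ∂((uniformLaw X).map fun v => v i), P x) →
      ∀ ω₀, P (X ω₀ i) := by
    intro i P hP ω₀
    by_contra hn
    exact uniformLaw_map_singleton_ne_zero X i ω₀
      (measure_mono_null (Set.singleton_subset_iff.2 hn) (ae_iff.1 hP))
  refine ⟨fun i x r => ?_, fun i x => ?_, ?_⟩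
  · by_cases hx : ∃ ω₀, X ω₀ i = x
    · obtain ⟨ω₀, rfl⟩ := hx
      have h := hae (hM.bic i) ω₀ r
      rw [interimUtility_uniformLaw, interimUtility_uniformLaw, hself] at h
      exact le_of_mul_le_mul_left (le_of_mul_le_mul_left h (hpos i ω₀)) hcard
    · push Not at hx
      simp [hx]
  · by_cases hx : ∃ ω₀, X ω₀ i = x
    · obtain ⟨ω₀, rfl⟩ := hx
      have h := hae (hM.iir i) ω₀
      rw [interimUtility_uniformLaw, hself] at h
      exact nonneg_of_mul_nonneg_right (nonneg_of_mul_nonneg_right h (hpos i ω₀)) hcard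
    · push Not at hx
      simp [hx]
  · have h := hM.wbb.2
    rw [integral_uniformLaw X (Finset.measurable_sum _ fun i _ => M.measurable_pay i)] at h
    exact nonneg_of_mul_nonneg_right h hcard

theorem gft_uniformLaw (M : Mechanism) (X : Ω → Profile) :
    M.gft (uniformLaw X) = (Fintype.card Ω : ℝ)⁻¹ * ∑ ω,
      (((X ω 1 : ℝ) - X ω 0) * M.alloc (X ω) 1 + ((X ω 2 : ℝ) - X ω 0) * M.alloc (X ω) 2) := by
  have h1 := M.measurable_alloc 1
  have h2 := M.measurable_alloc 2
  exact integral_uniformLaw X (by fun_prop)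

end

end Mechanism

end Trade
end

noncomputable section

namespace Trade

/-! ### The hard family of priors. -/

/-- The value of the second buyer with hint number `h`, by which the other values are shifted. -/
def hint (h : ℕ) : ℝ≥0 := 1 / (h + 4)

theorem hint_injective : Function.Injective hint := by
  intro h h' hh
  have := congrArg (fun z : ℝ≥0 => (z : ℝ)) hh
  simp only [hint] at this
  push_cast at this
  field_simp at this
  have h2 : (h : ℝ) = h' := by linarith
  exact_mod_cast h2

theorem hint_le (h : ℕ) : (hint h : ℝ) ≤ 1 / 4 := by
  simp only [hint]
  push_cast
  have : (0 : ℝ) ≤ h := Nat.cast_nonneg h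
  exact one_div_le_one_div_of_le (by norm_num) (by linarith)

/-- The seller's value, up to the shift; `true` means high. -/
def sellerValue (s : Bool) : ℝ≥0 := bif s then 9 / 20 else 0

/-- The first buyer's value, up to the shift; `true` means high. -/
def buyerValue (b : Bool) : ℝ≥0 := bif b then 1 / 2 else 1 / 20

/-- The profile with hint number `h` and the given types of the seller and the first buyer. -/
def point (h : ℕ) (s b : Bool) : Profile :=
  ![sellerValue s + hint h, buyerValue b + hint h, hint h]

/-- Two hints differ by less than 9/20, the gap between the two types. Hence an agent's value
reveals the hint and the agent's type, and the interim constraints split by hint. -/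
theorem sellerValue_add_hint_inj {h h' : ℕ} {s s' : Bool} :
    sellerValue s + hint h = sellerValue s' + hint h' ↔ h = h' ∧ s = s' := by
  refine ⟨fun e => ?_, by rintro ⟨rfl, rfl⟩; rfl⟩
  have e' := congrArg (fun z : ℝ≥0 => (z : ℝ)) e
  have h1 := hint_le h
  have h2 := hint_le h'
  have h3 := (hint h).coe_nonneg
  have h4 := (hint h').coe_nonneg
  cases s <;> cases s' <;> simp [sellerValue] at e e' ⊢
  · exact hint_injective e
  · linarith
  · linarith
  · exact hint_injective e

theorem buyerValue_add_hint_inj {h h' : ℕ} {b b' : Bool} :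
    buyerValue b + hint h = buyerValue b' + hint h' ↔ h = h' ∧ b = b' := by
  refine ⟨fun e => ?_, by rintro ⟨rfl, rfl⟩; rfl⟩
  have e' := congrArg (fun z : ℝ≥0 => (z : ℝ)) e
  have h1 := hint_le h
  have h2 := hint_le h'
  have h3 := (hint h).coe_nonneg
  have h4 := (hint h').coe_nonneg
  cases b <;> cases b' <;> simp [buyerValue] at e e' ⊢
  · exact hint_injective e
  · linarith
  · linarith
  · exact hint_injective e

@[simp]
theorem point_zero (h : ℕ) (s b : Bool) : point h s b 0 = sellerValue s + hint h := rfl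

@[simp]
theorem point_one (h : ℕ) (s b : Bool) : point h s b 1 = buyerValue b + hint h := rfl

@[simp]
theorem point_two (h : ℕ) (s b : Bool) : point h s b 2 = hint h := rfl

/-- Outcomes of the randomness which determines the types of the seller and the first buyer. -/
abbrev Coins : Type := Fin 4 × Fin 2

/-- The seller's type: high with probability `1 / 4` in state `false`, `1 / 2` in state `true`. -/
def sellerHigh (a : Bool) (k : Coins) : Bool := bif a then k.2 == 0 else k.1 == 0

/-- The first buyer's type: high with probability `1 / 2` in state `false`, `3 / 4` in state
`true`. -/
def buyerHigh (a : Bool) (k : Coins) : Bool := bif a then k.1 != 0 else k.2 == 0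

/-- The profile with hint number `h` when the state of this hint is `a`. -/
def statePoint (a : Bool) (h : ℕ) (k : Coins) : Profile :=
  point h (sellerHigh a k) (buyerHigh a k)

/-- The family of profiles in which `f` assigns to every hint its hidden state. -/
def family {N : ℕ} (f : Fin N → Bool) (ω : Fin N × Coins) : Profile := statePoint (f ω.1) ω.1 ω.2

theorem family_le_one {N : ℕ} (f : Fin N → Bool) (ω : Fin N × Coins) (i : Fin 3) :
    family f ω i ≤ 1 := by
  have h1 := hint_le ω.1
  rw [← NNReal.coe_le_coe]
  fin_cases i
  · cases h : sellerHigh (f ω.1) ω.2 <;>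
      simp [family, statePoint, point, h, sellerValue] <;> linarith
  · cases h : buyerHigh (f ω.1) ω.2 <;>
      simp [family, statePoint, point, h, buyerValue] <;> linarith
  · simp [family, statePoint, point]
    linarith

theorem sum_hint_eq {N : ℕ} (h : Fin N) (g : Fin N × Coins → ℝ)
    (P : Fin N × Coins → Prop) [DecidablePred P] (Q : Coins → Prop) [DecidablePred Q]
    (hP : ∀ h' k, P (h', k) ↔ h' = h ∧ Q k) :
    (∑ ω, if P ω then g ω else 0) = ∑ k, if Q k then g (h, k) else 0 := by
  rw [Fintype.sum_prod_type, Finset.sum_eq_single h]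
  · simp [hP]
  · intro h' _ hne
    simp [hP, hne]
  · simp

/-! ### Budget and gains at a single hint. -/

namespace Mechanism

variable {M : Mechanism} {N : ℕ} {f : Fin N → Bool}

theorem SatisfiesFinite.seller_ic (hM : M.SatisfiesFinite (family f)) (h : Fin N) (s s' : Bool) :
    (∑ k, if sellerHigh (f h) k = s then
        M.utility 0 (sellerValue s + hint h) (point h s' (buyerHigh (f h) k)) else 0) ≤
      ∑ k, if sellerHigh (f h) k = s then
        M.utility 0 (sellerValue s + hint h) (point h s (buyerHigh (f h) k)) else 0 := by
  have key := hM.ic 0 (sellerValue s + hint h) (sellerValue s' + hint h)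
  have hP : ∀ (h' : Fin N) (k : Coins), family f (h', k) 0 = sellerValue s + hint h ↔
      h' = h ∧ sellerHigh (f h) k = s := by
    intro h' k
    simp only [family, statePoint, point, Matrix.cons_val_zero, sellerValue_add_hint_inj, Fin.ext_iff]
    constructor <;> rintro ⟨e, e'⟩ <;> obtain rfl := Fin.ext e <;> exact ⟨rfl, e'⟩
  rw [sum_hint_eq h _ _ _ hP, sum_hint_eq h _ _ _ hP] at key
  refine (Finset.sum_congr rfl fun k _ => ?_).trans_le
    (key.trans_eq (Finset.sum_congr rfl fun k _ => ?_))
  · congr 2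
    ext i
    fin_cases i <;> simp [family, statePoint, point]
  · split_ifs with hk
    · subst hk
      rfl
    · rfl

theorem SatisfiesFinite.buyer_ic (hM : M.SatisfiesFinite (family f)) (h : Fin N) (b b' : Bool) :
    (∑ k, if buyerHigh (f h) k = b then
        M.utility 1 (buyerValue b + hint h) (point h (sellerHigh (f h) k) b') else 0) ≤
      ∑ k, if buyerHigh (f h) k = b then
        M.utility 1 (buyerValue b + hint h) (point h (sellerHigh (f h) k) b) else 0 := by
  have key := hM.ic 1 (buyerValue b + hint h) (buyerValue b' + hint h)
  have hP : ∀ (h' : Fin N) (k : Coins), family f (h', k) 1 = buyerValue b + hint h ↔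
      h' = h ∧ buyerHigh (f h) k = b := by
    intro h' k
    simp only [family, statePoint, point, Matrix.cons_val_one, Matrix.cons_val_zero,
      buyerValue_add_hint_inj]
    constructor <;> rintro ⟨e, e'⟩
    · obtain rfl := Fin.ext e
      exact ⟨rfl, e'⟩
    · exact ⟨by rw [e], by rw [e]; exact e'⟩
  rw [sum_hint_eq h _ _ _ hP, sum_hint_eq h _ _ _ hP] at key
  refine (Finset.sum_congr rfl fun k _ => ?_).trans_le
    (key.trans_eq (Finset.sum_congr rfl fun k _ => ?_))
  · congr 2
    ext i
    fin_cases i <;> simp [family, statePoint, point]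
  · split_ifs with hk
    · subst hk
      rfl
    · rfl

theorem SatisfiesFinite.seller_ir (hM : M.SatisfiesFinite (family f)) (h : Fin N) (s : Bool) :
    0 ≤ ∑ k, if sellerHigh (f h) k = s then
        M.utility 0 (sellerValue s + hint h) (point h s (buyerHigh (f h) k)) else 0 := by
  have key := hM.ir 0 (sellerValue s + hint h)
  have hP : ∀ (h' : Fin N) (k : Coins), family f (h', k) 0 = sellerValue s + hint h ↔
      h' = h ∧ sellerHigh (f h) k = s := by
    intro h' k
    simp only [family, statePoint, point, Matrix.cons_val_zero, sellerValue_add_hint_inj, Fin.ext_iff]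
    constructor <;> rintro ⟨e, e'⟩ <;> obtain rfl := Fin.ext e <;> exact ⟨rfl, e'⟩
  rw [sum_hint_eq h _ _ _ hP] at key
  convert key using 4 with k _ hk
  rw [← hk]; rfl

theorem SatisfiesFinite.buyer_ir (hM : M.SatisfiesFinite (family f)) (h : Fin N) (b : Bool) :
    0 ≤ ∑ k, if buyerHigh (f h) k = b then
        M.utility 1 (buyerValue b + hint h) (point h (sellerHigh (f h) k) b) else 0 := by
  have key := hM.ir 1 (buyerValue b + hint h)
  have hP : ∀ (h' : Fin N) (k : Coins), family f (h', k) 1 = buyerValue b + hint h ↔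
      h' = h ∧ buyerHigh (f h) k = b := by
    intro h' k
    simp only [family, statePoint, point, Matrix.cons_val_one, Matrix.cons_val_zero,
      buyerValue_add_hint_inj, Fin.ext_iff]
    constructor <;> rintro ⟨e, e'⟩ <;> obtain rfl := Fin.ext e <;> exact ⟨rfl, e'⟩
  rw [sum_hint_eq h _ _ _ hP] at key
  convert key using 4 with k _ hk
  rw [← hk]; rfl

theorem SatisfiesFinite.second_buyer_ir (hM : M.SatisfiesFinite (family f)) (h : Fin N) :
    0 ≤ ∑ k, M.utility 2 (hint h) (statePoint (f h) h k) := by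
  have key := hM.ir 2 (hint h)
  have hP : ∀ (h' : Fin N) (k : Coins), family f (h', k) 2 = hint h ↔ h' = h ∧ True := by
    intro h' k
    simp [family, statePoint, point, hint_injective.eq_iff, Fin.ext_iff]
  rw [sum_hint_eq h _ _ _ hP] at key
  simp only [if_true] at key
  exact key

/-- The probability of the two trades with small gains at hint number `h`. -/
def smallTrades (M : Mechanism) (h : ℕ) : ℝ :=
  M.alloc (point h false false) 1 + M.alloc (point h true true) 1

/-- This is Myerson's virtual surplus bound, with a factor 8 for the coins. The large trade yields 3
· 1/2. The low buyer's virtual value and the high seller's virtual cost make the likelier small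
trade contribute -6/5 and the other -13/10, in either state. The common shift cancels, and trades
with the second buyer bring nothing. -/
theorem SatisfiesFinite.sum_pay_le (hM : M.SatisfiesFinite (family f)) (h : Fin N) :
    ∑ k, ∑ i, M.pay (statePoint (f h) h k) i ≤ 3 / 2 - 6 / 5 * M.smallTrades h := by
  have h1 := hM.seller_ic h false true
  have h2 := hM.seller_ir h true
  have h3 := hM.buyer_ic h true false
  have h4 := hM.buyer_ir h false
  have h5 := hM.second_buyer_ir h
  have hs := fun s b => M.alloc_sum (point h s b)
  have n1 := fun s b => M.alloc_nonneg (point h s b) 1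
  have n2 := fun s b => M.alloc_nonneg (point h s b) 2
  have n0 := fun s b => M.alloc_nonneg (point h s b) 0
  simp only [Fin.sum_univ_three] at hs
  have a0 := fun s b => (show M.alloc (point h s b) 0 =
    1 - M.alloc (point h s b) 1 - M.alloc (point h s b) 2 by linarith [hs s b])
  cases hf : f h <;>
  · rw [hf] at h1 h2 h3 h4 h5
    simp [Fintype.sum_prod_type, Fin.sum_univ_four, sellerHigh, buyerHigh, statePoint, utility,
      tradeProb, sellerValue, buyerValue, Fin.sum_univ_three, smallTrades, a0] at h1 h2 h3 h4 h5 ⊢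
    -- Within a hint the two types are independent, so the payments in a misreport constraint are a
    -- multiple of those in the participation constraint of the imitated type and can be eliminated.
    linarith [n1 false false, n1 true true, n1 true false, n1 false true, n2 false false,
      n2 false true, n2 true false, n2 true true, n0 false true, hs false true]

/-- Eight times the expected gains from trade at hint number `h` in state `a`. -/
def gain (M : Mechanism) (h : ℕ) (a : Bool) : ℝ :=
  ∑ k, (((statePoint a h k 1 : ℝ) - statePoint a h k 0) * M.alloc (statePoint a h k) 1 +
    ((statePoint a h k 2 : ℝ) - statePoint a h k 0) * M.alloc (statePoint a h k) 2)

theorem gain_eq_false (M : Mechanism) (h : ℕ) :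
    M.gain h false = 3 / 2 * M.alloc (point h false true) 1 +
      3 / 20 * M.alloc (point h false false) 1 + 1 / 20 * M.alloc (point h true true) 1 -
      2 / 5 * M.alloc (point h true false) 1 -
      9 / 20 * (M.alloc (point h true false) 2 + M.alloc (point h true true) 2) := by
  simp [gain, Fintype.sum_prod_type, Fin.sum_univ_four, sellerHigh, buyerHigh, statePoint,
    sellerValue, buyerValue]
  ring

theorem gain_eq_true (M : Mechanism) (h : ℕ) :
    M.gain h true = 3 / 2 * M.alloc (point h false true) 1 +
      1 / 20 * M.alloc (point h false false) 1 + 3 / 20 * M.alloc (point h true true) 1 -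
      2 / 5 * M.alloc (point h true false) 1 -
      9 / 20 * (M.alloc (point h true false) 2 + 3 * M.alloc (point h true true) 2) := by
  simp [gain, Fintype.sum_prod_type, Fin.sum_univ_four, sellerHigh, buyerHigh, statePoint,
    sellerValue, buyerValue]
  ring

theorem alloc_le_one (M : Mechanism) (v : Profile) (i : Fin 3) : M.alloc v i ≤ 1 :=
  (Finset.single_le_sum (fun j _ => M.alloc_nonneg v j) (Finset.mem_univ i)).trans_eq
    (M.alloc_sum v)

/-- Over both states together a small trade is worth only 3/20 + 1/20, whichever of the two it is.
-/
theorem gain_add_gain_not_le (M : Mechanism) (h : ℕ) (a : Bool) :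
    M.gain h a + M.gain h (!a) ≤ 3 + 1 / 5 * M.smallTrades h := by
  have n1 := fun s b => M.alloc_nonneg (point h s b) 1
  have n2 := fun s b => M.alloc_nonneg (point h s b) 2
  have := M.alloc_le_one (point h false true) 1
  cases a <;> simp only [Bool.not_true, Bool.not_false, gain_eq_false, gain_eq_true, smallTrades] <;>
    linarith [n1 true false, n2 true false, n2 true true]

theorem gain_le (M : Mechanism) (h : ℕ) (a : Bool) : M.gain h a ≤ 17 / 10 := by
  have n1 := fun s b => M.alloc_nonneg (point h s b) 1
  have n2 := fun s b => M.alloc_nonneg (point h s b) 2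
  have l := fun s b => M.alloc_le_one (point h s b) 1
  cases a <;> simp only [gain_eq_false, gain_eq_true] <;>
    linarith [n1 true false, n2 true false, n2 true true, l false true, l false false, l true true]

theorem smallTrades_nonneg (M : Mechanism) (h : ℕ) : 0 ≤ M.smallTrades h :=
  add_nonneg (M.alloc_nonneg _ _) (M.alloc_nonneg _ _)

/-- Budget balance only holds summed over the hints, so one hint may subsidize another. The bound is
(3/2) / (6/5) per hint. -/
theorem SatisfiesFinite.sum_smallTrades_le (hM : M.SatisfiesFinite (family f)) :
    ∑ h : Fin N, M.smallTrades h ≤ 5 / 4 * N := by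
  have h1 := hM.bb
  rw [Fintype.sum_prod_type] at h1
  have h2 := h1.trans (Finset.sum_le_sum fun h _ => hM.sum_pay_le h)
  simp only [Finset.sum_sub_distrib, Finset.sum_const, Finset.card_univ, Fintype.card_fin,
    nsmul_eq_mul, ← Finset.mul_sum] at h2
  linarith

theorem gft_family (M : Mechanism) (f : Fin N → Bool) :
    M.gft (uniformLaw (family f)) = (N * 8 : ℝ)⁻¹ * ∑ h : Fin N, M.gain h (f h) := by
  rw [gft_uniformLaw, Fintype.sum_prod_type]
  simp only [Fintype.card_prod, Fintype.card_fin]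
  exact congrArg₂ _ (by norm_num) rfl

/-- Two priors of the family that differ except on `t` hints cannot both be served well by the
same allocation rule. -/
theorem not_sum_gain_ge_of_flip (M : Mechanism) {N t : ℕ} (hN : 17 * t < N) (f : Fin N → Bool)
    (B : Finset (Fin N)) (hB : B.card ≤ t) (hsmall : ∑ h : Fin N, M.smallTrades h ≤ 5 / 4 * N)
    (h1 : (33 / 20 - 1 / 80) * N ≤ ∑ h : Fin N, M.gain h (f h))
    (h2 : (33 / 20 - 1 / 80) * N ≤ ∑ h : Fin N, M.gain h (if h ∈ B then f h else !f h)) : False := by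
  have key : ∀ h : Fin N, M.gain h (f h) + M.gain h (if h ∈ B then f h else !f h) ≤
      3 + 1 / 5 * M.smallTrades h + if h ∈ B then 2 / 5 else 0 := by
    intro h
    have := M.smallTrades_nonneg h
    split_ifs
    · linarith [M.gain_le h (f h)]
    · linarith [M.gain_add_gain_not_le h (f h)]
  have h3 := Finset.sum_le_sum fun h (_ : h ∈ Finset.univ) => key h
  simp only [Finset.sum_add_distrib, Finset.sum_const, Finset.card_univ, Fintype.card_fin,
    nsmul_eq_mul, ← Finset.mul_sum, Finset.sum_ite_mem, Finset.univ_inter] at h3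
  have h4 : (B.card : ℝ) ≤ t := by exact_mod_cast hB
  have h5 : (17 * t : ℝ) < N := by exact_mod_cast hN
  -- Per hint, the assumptions give 33/10 - 1/40, whereas the upper bound is 3 + 1/4 + (2/5)(t/N).
  -- Since t/N < 1/17, the last term is below 1/40.
  linarith

/-! ### The simple benchmark. -/

/-- The mechanism in which the second buyer's report determines the price offered to the seller
and the first buyer. -/
def postedPrice (π : ℝ≥0 → ℝ≥0) (hπ : Measurable π) : Mechanism where
  alloc v i := if v 0 ≤ π (v 2) ∧ π (v 2) ≤ v 1 then (if i = 1 then 1 else 0)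
    else if i = 0 then 1 else 0
  pay v i := if v 0 ≤ π (v 2) ∧ π (v 2) ≤ v 1 then
    (if i = 0 then -(π (v 2) : ℝ) else if i = 1 then π (v 2) else 0) else 0
  alloc_nonneg v i := by split_ifs <;> norm_num
  alloc_sum v := by split_ifs <;> simp
  measurable_alloc i := Measurable.ite
    ((measurableSet_le (by fun_prop) (by fun_prop)).inter
      (measurableSet_le (by fun_prop) (by fun_prop))) measurable_const measurable_const
  measurable_pay i := by
    refine Measurable.ite ((measurableSet_le (by fun_prop) (by fun_prop)).inter
      (measurableSet_le (by fun_prop) (by fun_prop))) ?_ measurable_const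
    split_ifs <;> fun_prop

/-- The price depends only on the report of the second buyer, who never trades and so is
indifferent; the other two face a price they cannot influence. -/
theorem isSimple_postedPrice (π : ℝ≥0 → ℝ≥0) (hπ : Measurable π) :
    (postedPrice π hπ).IsSimple where
  deterministic v := by
    by_cases h : v 0 ≤ π (v 2) ∧ π (v 2) ≤ v 1
    · exact ⟨1, by simp [postedPrice, h]⟩
    · exact ⟨0, by simp [postedPrice, h]⟩
  dsic i x r w := by
    fin_cases i
    · simp [postedPrice, utility, tradeProb]
      split_ifs <;> (simp_all; try order)
    · simp [postedPrice, utility, tradeProb]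
      split_ifs <;> (simp_all; try order)
    · simp [postedPrice, utility, tradeProb]
  normalized v i := by
    by_cases h : v 0 ≤ π (v 2) ∧ π (v 2) ≤ v 1
    · fin_cases i <;> simp [postedPrice, tradeProb, h]
    · simp [postedPrice, h]
  sbb v := by
    by_cases h : v 0 ≤ π (v 2) ∧ π (v 2) ≤ v 1 <;> simp [postedPrice, h, Fin.sum_univ_three]
  ir i x w := by
    fin_cases i
    · simp [postedPrice, utility, tradeProb]
      split_ifs <;> simp_all
    · simp [postedPrice, utility, tradeProb]
      split_ifs <;> simp_all
    · simp [postedPrice, utility, tradeProb]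

open Classical in
/-- A price that knows the state of every hint. -/
def hintPrice (f : Fin N → Bool) (z : ℝ≥0) : ℝ≥0 :=
  z + if z ∈ (fun h : Fin N => hint h) '' {h | f h = true} then 9 / 20 else 1 / 20

theorem measurable_hintPrice (f : Fin N → Bool) : Measurable (hintPrice f) :=
  measurable_id.add (Measurable.ite (Set.toFinite ((fun h : Fin N => hint h) '' {h | f h = true})).measurableSet measurable_const
    measurable_const)

theorem hintPrice_hint (f : Fin N → Bool) (h : Fin N) :
    hintPrice f (hint h) = hint h + bif f h then 9 / 20 else 1 / 20 := by
  have : (hint h ∈ (fun h : Fin N => hint h) '' {h | f h = true}) ↔ f h = true := by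
    simp only [Set.mem_image, Set.mem_ofPred_eq, hint_injective.eq_iff, ← Fin.ext_iff]
    simp
  simp only [hintPrice, this]
  cases f h <;> simp

theorem gain_postedPrice (f : Fin N → Bool) (h : Fin N) :
    (postedPrice (hintPrice f) (measurable_hintPrice f)).gain h (f h) = 33 / 20 := by
  have e1 : ¬ (9 / 20 : ℝ≥0) ≤ 1 / 20 := by rw [← NNReal.coe_le_coe]; norm_num
  have e2 : (9 / 20 : ℝ≥0) ≤ 1 / 2 := by rw [← NNReal.coe_le_coe]; norm_num
  have e3 : (1 / 20 : ℝ≥0) ≤ 1 / 2 := by rw [← NNReal.coe_le_coe]; norm_num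
  have e4 := hintPrice_hint f h
  cases hf : f h <;> rw [hf] at e4
  · rw [gain_eq_false]
    simp only [postedPrice, point_zero, point_one, point_two, e4, sellerValue, buyerValue,
      add_comm (hint h), add_le_add_iff_right, cond_true, cond_false, e1, e3]
    norm_num [Fin.ext_iff]
  · rw [gain_eq_true]
    simp only [postedPrice, point_zero, point_one, point_two, e4, sellerValue, buyerValue,
      add_comm (hint h), add_le_add_iff_right, cond_true, cond_false, e1, e2]
    norm_num [Fin.ext_iff]

theorem IsNearOptimal.sum_gain_ge (hN : 0 < N)
    (hM : M.IsNearOptimal (uniformLaw (family f)) (1 / 640)) :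
    (33 / 20 - 1 / 80) * N ≤ ∑ h : Fin N, M.gain h (f h) := by
  have h := hM _ (isSimple_postedPrice (hintPrice f) (measurable_hintPrice f))
  have hN' : (0 : ℝ) < N := by exact_mod_cast hN
  rw [gft_family, gft_family] at h
  simp only [gain_postedPrice, Finset.sum_const, Finset.card_univ, Fintype.card_fin,
    nsmul_eq_mul] at h
  field_simp at h
  linarith

end Mechanism

end Trade
end

noncomputable section

namespace Trade

/-! ### Averaging over the hidden states and learning from samples. -/

/-- Pointwise in `a`, reindexing by `Φ a` counts the good `f` twice while each pair `f`, `Φ a f`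
contributes at most one. Integrating gives the bound. The permutation may depend on `a` without any
measurability. -/
theorem two_mul_sum_measureReal_le {α F : Type*} [MeasurableSpace α] [Fintype F] (Q : Measure α)
    [IsProbabilityMeasure Q] (G : F → Set α) (hG : ∀ f, MeasurableSet (G f))
    (Φ : α → Equiv.Perm F) (hΦ : ∀ a f, a ∈ G f → a ∉ G (Φ a f)) :
    2 * ∑ f, Q.real (G f) ≤ Fintype.card F := by
  have hint : ∀ f, Integrable ((G f).indicator (1 : α → ℝ)) Q := fun f =>
    (integrable_const 1).indicator (hG f)
  have h1 : ∑ f, Q.real (G f) = ∫ a, ∑ f, (G f).indicator (1 : α → ℝ) a ∂Q := by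
    rw [integral_finsetSum _ fun f _ => hint f]
    exact Finset.sum_congr rfl fun f _ => (integral_indicator_one (hG f)).symm
  have h2 : ∀ a, ∑ f, (G f).indicator (1 : α → ℝ) a ≤ (Fintype.card F : ℝ) / 2 := by
    intro a
    have h3 := Equiv.sum_comp (Φ a) fun f => (G f).indicator (1 : α → ℝ) a
    have h4 : ∑ f, ((G f).indicator (1 : α → ℝ) a + (G (Φ a f)).indicator (1 : α → ℝ) a) ≤
        ∑ _f : F, (1 : ℝ) := by
      refine Finset.sum_le_sum fun f _ => ?_
      by_cases hf : a ∈ G f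
      · simp [hf, hΦ a f hf]
      · rw [Set.indicator_of_notMem hf, zero_add]
        exact Set.indicator_le_self' (fun _ _ => zero_le_one) a
    rw [Finset.sum_add_distrib, h3] at h4
    simp only [Finset.sum_const, Finset.card_univ, nsmul_eq_mul, mul_one] at h4
    linarith
  have h5 := integral_mono (integrable_finsetSum _ fun f _ => hint f)
    (integrable_const ((Fintype.card F : ℝ) / 2)) (μ := Q) h2
  rw [h1]
  simp only [integral_const, probReal_univ, one_smul] at h5
  linarith

/-- Flipping the values of a Boolean function outside of `B`. -/
def flipOutside {H : Type*} [DecidableEq H] (B : Finset H) : Equiv.Perm (H → Bool) :=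
  Function.Involutive.toPerm (fun f h => if h ∈ B then f h else !f h) fun f => by
    ext h
    by_cases hh : h ∈ B <;> simp [hh]

theorem flipOutside_apply {H : Type*} [DecidableEq H] (B : Finset H) (f : H → Bool) (h : H) :
    flipOutside B f h = if h ∈ B then f h else !f h := rfl

namespace LearningAlgorithm

variable {t N : ℕ}

/-- The samples and seeds on which the allocation rule of the output satisfies the necessary
conditions for success on the prior given by `f`. -/
def necessarySet (L : LearningAlgorithm.{u} t) (f : Fin N → Bool) :
    Set ((Fin t → Profile) × L.Seed) :=
  {z | ∑ h : Fin N, (L.output z.1 z.2).smallTrades h ≤ 5 / 4 * N ∧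
    (33 / 20 - 1 / 80) * N ≤ ∑ h : Fin N, (L.output z.1 z.2).gain h (f h)}

/-- The conditions involve allocations alone, since payments need not depend measurably on samples
and seed. -/
theorem measurableSet_necessarySet (L : LearningAlgorithm.{u} t) (f : Fin N → Bool) :
    MeasurableSet (L.necessarySet f) := by
  have hm : ∀ (v : Profile) (i : Fin 3), Measurable fun z : (Fin t → Profile) × L.Seed =>
      (L.output z.1 z.2).alloc v i := fun v i =>
    (L.measurable_output i).comp (g := fun z : (Fin t → Profile) × L.Seed × Profile =>
      (L.output z.1 z.2.1).alloc z.2.2 i) (f := fun z : (Fin t → Profile) × L.Seed => (z.1, z.2, v))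
      (by fun_prop)
  refine MeasurableSet.inter (measurableSet_le (f := fun z : (Fin t → Profile) × L.Seed =>
      ∑ h : Fin N, (L.output z.1 z.2).smallTrades h) ?_ measurable_const)
    (measurableSet_le (g := fun z : (Fin t → Profile) × L.Seed =>
      ∑ h : Fin N, (L.output z.1 z.2).gain h (f h)) measurable_const ?_)
  · exact Finset.measurable_sum _ fun h _ => (hm _ _).add (hm _ _)
  · exact Finset.measurable_sum _ fun h _ => Finset.measurable_sum _ fun k _ =>
      ((hm _ _).const_mul _).add ((hm _ _).const_mul _)

/-- Pulling the samples back to hints and coins puts all assignments `f` on one probability space,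
where they can be compared pointwise. -/
theorem successProb_family_le (L : LearningAlgorithm.{u} t) [NeZero N] (f : Fin N → Bool) :
    L.successProb (uniformLaw (family f)) (1 / 640) ≤
      ((Measure.pi fun _ : Fin t => uniformOn (Set.univ : Set (Fin N × Coins))).prod
        L.seedLaw).real {z | ((fun j => family f (z.1 j)), z.2) ∈ L.necessarySet f} := by
  have hX : Measurable (family f) := measurable_of_finite _
  have hsub : ∀ M : Mechanism, (M.IsSimple ∨ M.IsGeneral (uniformLaw (family f))) →
      M.SatisfiesFinite (family f) := fun M hM =>
    hM.elim (fun h => h.satisfiesFinite _) fun h => h.satisfiesFinite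
  have hpi : (Measure.pi fun _ : Fin t => uniformLaw (family f)) =
      (Measure.pi fun _ : Fin t => uniformOn (Set.univ : Set (Fin N × Coins))).map
        fun ω j => family f (ω j) :=
    (Measure.pi_map_pi fun _ => hX.aemeasurable).symm
  have hmap : (Measure.pi fun _ : Fin t => uniformLaw (family f)).prod L.seedLaw =
      ((Measure.pi fun _ : Fin t => uniformOn (Set.univ : Set (Fin N × Coins))).prod
        L.seedLaw).map (Prod.map (fun ω j => family f (ω j)) id) := by
    rw [hpi]
    conv_lhs => rw [← Measure.map_id (μ := L.seedLaw)]
    exact Measure.map_prod_map _ _ (by fun_prop) measurable_id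
  have hle : L.successProb (uniformLaw (family f)) (1 / 640) ≤
      ((Measure.pi fun _ : Fin t => uniformLaw (family f)).prod L.seedLaw).real
        (L.necessarySet f) :=
    measureReal_mono fun z hz => ⟨(hsub _ hz.1).sum_smallTrades_le,
      hz.2.sum_gain_ge (NeZero.pos N)⟩
  refine hle.trans_eq ?_
  rw [hmap, map_measureReal_apply (by fun_prop) (L.measurableSet_necessarySet f)]
  rfl

end LearningAlgorithm

end Trade

end

theorem mainTheorem1 :
    ∃ c : ℝ, 0 < c ∧ ∀ (t : ℕ) (p : ℝ), 1 / 2 < p →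
      ¬ ∃ L : Trade.LearningAlgorithm.{u} t,
        ∀ (V : MeasureTheory.Measure Trade.Profile) [MeasureTheory.IsProbabilityMeasure V],
          (∀ᵐ v ∂V, ∀ i, v i ≤ 1) → p ≤ L.successProb V c := by
  -- Since `gain` carries a factor 8, this error is 1/80 per hint in the units of `gain`.
  refine ⟨1 / 640, by norm_num, fun t p hp => ?_⟩
  rintro ⟨L, hL⟩
  set N : ℕ := 17 * t + 1 with hN
  have hX : ∀ f : Fin N → Bool, Measurable (Trade.family f) := fun f => measurable_of_finite _
  have hsupp : ∀ f : Fin N → Bool, ∀ᵐ v ∂(Trade.uniformLaw (Trade.family f)), ∀ i, v i ≤ 1 := by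
    intro f
    refine (ae_map_iff (hX f).aemeasurable ?_).2 (ae_of_all _ (Trade.family_le_one f))
    have hm : ∀ i, MeasurableSet {v : Trade.Profile | v i ≤ 1} := fun i =>
      measurableSet_le (measurable_pi_apply i) measurable_const
    measurability
  have hprob := fun f : Fin N → Bool =>
    (hL (Trade.uniformLaw (Trade.family f)) (hsupp f)).trans (L.successProb_family_le f)
  have hle := Trade.two_mul_sum_measureReal_le
    ((Measure.pi fun _ : Fin t => uniformOn (Set.univ : Set (Fin N × Trade.Coins))).prod L.seedLaw)
    (fun f : Fin N → Bool => {z | ((fun j => Trade.family f (z.1 j)), z.2) ∈ L.necessarySet f})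
    (fun f => (L.measurableSet_necessarySet f).preimage (by have := hX f; fun_prop))
    (fun z => Trade.flipOutside (Finset.univ.image fun j => (z.1 j).1)) (by
      intro z f h1 h2
      -- The flip spares every hint that was sampled, so the algorithm sees the same input.
      have hsame : (fun j => Trade.family (Trade.flipOutside
          (Finset.univ.image fun j => (z.1 j).1) f) (z.1 j)) = fun j => Trade.family f (z.1 j) := by
        ext1 j
        simp [Trade.family, Trade.flipOutside_apply]
      simp only [Set.mem_ofPred_eq, hsame] at h2
      refine Trade.Mechanism.not_sum_gain_ge_of_flip _ (t := t) (by omega) f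
        (Finset.univ.image fun j => (z.1 j).1) ?_ h1.1 h1.2 h2.2
      exact Finset.card_image_le.trans (by simp))
  have hge := Finset.sum_le_sum fun f (_ : f ∈ Finset.univ) => hprob f
  have hcard : (0 : ℝ) < Fintype.card (Fin N → Bool) := by
    exact_mod_cast Fintype.card_pos
  simp only [Finset.sum_const, Finset.card_univ, nsmul_eq_mul] at hge
  nlinarith
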